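/- **Setting.** A sequence of $n$ tokens is $X=(x_1,\dots,x_n)\in\mathbb R^{n\times d}$, with rows $x_i\in\mathbb R^d$. Let $e:\mathbb R^m\times\mathbb R^m\to\mathbb R$ be a scoring function (for instance the inner product, possibly scaled). For matrices $W_q,W_k,W_v\in\mathbb R^{d\times m}$ put $q_i=x_iW_q$, $k_j=x_jW_k$, $v_j=x_jW_v$. *Standard attention* is the map $\mathbb R^{n\times d}\to\mathbb R^{n\times m}$, $$x_i'=\sum_{j=1}^n \operatorname{softmax}_j\big(e(q_i,k_j)\big)\,v_j ,$$ and *prime attention* with primers $F_{ij}\in\mathbb R^m$ $(1\le i,j\le n)$ is $$\tilde x_i'=\sum_{j=1}^n \operatorname{softmax}_j\big(e(q_i,k_j\odot F_{ij})\big)\,(v_j\odot F_{ij}),$$ where $\odot$ is the entrywise product. A *transformer block* with $h$ heads of size $m$ and $r$ hidden units maps $X$ first to $Y=X+\sum_{a=1}^h A_a(X)W_O^{a}$, where each $A_a$ is an attention head and $W_O^a\in\mathbb R^{m\times d}$, and then, token by token, to $y_i+\operatorname{ReLU}(y_iW_1+b_1)W_2+b_2$ with $W_1\in\mathbb R^{d\times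 r}$, $W_2\in\mathbb R^{r\times d}$, $b_1\in\mathbb R^r$, $b_2\in\mathbb R^d$. The classes $\mathcal T_{\rm std}^{h,m,r}$ and $\mathcal T_{\rm prime}^{h,m,r}$ consist of all finite compositions of such blocks whose heads are all standard, respectively prime, attention heads (each head in each block having its own matrices and primers); for a class $\mathcal T$ let $\mathcal T_P$ be the class of maps $X\mapsto T(X+E)$ with $T\in\mathcal T$ and a trainable positional encoding $E\in\mathbb R^{n\times d}$. All these classes depend on $n$, $d$ and $e$. **Theorem.** Prime attention satisfies the universal approximation theorem. Precisely, for all $n,d,m$ and every scoring function $e$ on $\mathbb R^m$: 1. If $F_{ij}=(1,\dots,1)$ for all $i,j$, prime attention equals standard attention with the same $W_q,W_k,W_v$. 2. Every map represented by standard attention is represented by prime attention; and $\mathcal T_{\rm std}^{h,m,r}\subseteq\mathcal T_{\rm prime}^{h,m,r}$, $\mathcal T_{{\rm std},P}^{h,m,r}\subseteq\mathcal T_{{\rm prime},P}^{h,m,r}$ for all $h,r$. 3. Let $h\ge2$, $m\ge1$, $r\ge4$. For every compact $D\subset\mathbb R^{n\times d}$, every continuous $f:D\to\mathbb R^{n\times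 d}$, every $1\le p<\infty$ and every $\varepsilon>0$ there is $g\in\mathcal T_{{\rm prime},P}^{h,m,r}$ with $$\Big(\int_D\sum_{i,k}|f(X)_{ik}-g(X)_{ik}|^p\,dX\Big)^{1/p}\le\varepsilon .$$ 4. More generally, let $h\ge2$, $m\ge1$, $r\ge4$, let $n,n'\le N$, let $D\subset\mathbb R^{n\times d}$ be compact and $f:D\to\mathbb R^{n'\times d}$ continuous, and let $1\le p<\infty$, $\varepsilon>0$. Then there is $g\in\mathcal T_{{\rm prime},P}^{h,m,r}$ on sequences of $N$ tokens such that the map which appends $N-n$ zero tokens to $X$, applies $g$ and keeps the first $n'$ tokens of the result is within $\varepsilon$ of $f$ in the same $L^p$ distance on $D$. -/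

import Mathlib

open MeasureTheory
open scoped BigOperators ENNReal Matrix

noncomputable section

namespace PrimeAttention

/-- Sequences of `n` tokens in `ℝ^d`; `X i` is the `i`-th token, a row vector. -/
abbrev TokenSeq (n d : ℕ) : Type := Fin n → Fin d → ℝ

/-- Pairwise scoring functions comparing a query with a key. -/
abbrev Score (m : ℕ) : Type := (Fin m → ℝ) → (Fin m → ℝ) → ℝ

/-- A primer for every ordered pair of token positions. -/
abbrev Primer (n m : ℕ) : Type := Fin n → Fin n → Fin m → ℝ

/-- The softmax of a vector of scores. -/
def softmax {n : ℕ} (s : Fin n → ℝ) (j : Fin n) : ℝ :=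
  Real.exp (s j) / ∑ l, Real.exp (s l)

/-- The projection matrices of one attention head. -/
structure HeadParams (d m : ℕ) where
  WQ : Matrix (Fin d) (Fin m) ℝ
  WK : Matrix (Fin d) (Fin m) ℝ
  WV : Matrix (Fin d) (Fin m) ℝ

/-- Standard attention:
`x'_i = ∑_j softmax_j (e (q_i, k_j)) v_j` with `q_i = x_i W_q`, `k_j = x_j W_k`, `v_j = x_j W_v`. -/
def standardAttention {n d m : ℕ} (e : Score m) (θ : HeadParams d m) (X : TokenSeq n d) :
    TokenSeq n m :=
  fun i => ∑ j, softmax (fun l => e (X i ᵥ* θ.WQ) (X l ᵥ* θ.WK)) j • (X j ᵥ* θ.WV)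

/-- Prime attention: for the query token `i`, the key and the value of token `j` are multiplied
entrywise by the primer `F i j`. -/
def primeAttention {n d m : ℕ} (e : Score m) (θ : HeadParams d m) (F : Primer n m)
    (X : TokenSeq n d) : TokenSeq n m :=
  fun i => ∑ j, softmax (fun l => e (X i ᵥ* θ.WQ) ((X l ᵥ* θ.WK) * F i l)) j •
    ((X j ᵥ* θ.WV) * F i j)

/-- The functions represented by one standard attention head. -/
def standardAttentionClass (n d : ℕ) {m : ℕ} (e : Score m) :
    Set (TokenSeq n d → TokenSeq n m) :=
  {A | ∃ θ : HeadParams d m, A = standardAttention e θ}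

/-- The functions represented by one prime attention head. -/
def primeAttentionClass (n d : ℕ) {m : ℕ} (e : Score m) :
    Set (TokenSeq n d → TokenSeq n m) :=
  {A | ∃ (θ : HeadParams d m) (F : Primer n m), A = primeAttention e θ F}

/-- Parameters of a token-wise feed-forward layer with `r` hidden units. -/
structure FeedForwardParams (d r : ℕ) where
  W1 : Matrix (Fin d) (Fin r) ℝ
  b1 : Fin r → ℝ
  W2 : Matrix (Fin r) (Fin d) ℝ
  b2 : Fin d → ℝ

/-- The ReLU feed-forward layer with residual connection, applied to each token separately. -/
def feedForward {n d r : ℕ} (φ : FeedForwardParams d r) (X : TokenSeq n d) : TokenSeq n d :=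
  fun i => X i + ((fun a => max ((X i ᵥ* φ.W1 + φ.b1) a) 0) ᵥ* φ.W2 + φ.b2)

/-- The multi-head attention layer with residual connection built from the heads `A a`, with
output matrices `WO a`. -/
def multiHead {n d m h : ℕ} (A : Fin h → TokenSeq n d → TokenSeq n m)
    (WO : Fin h → Matrix (Fin m) (Fin d) ℝ) (X : TokenSeq n d) : TokenSeq n d :=
  fun i => X i + ∑ a, A a X i ᵥ* WO a

/-- Standard transformer blocks with `h` heads of size `m` and `r` hidden feed-forward units. -/
def standardBlocks (n d : ℕ) {m : ℕ} (e : Score m) (h r : ℕ) :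
    Set (TokenSeq n d → TokenSeq n d) :=
  {T | ∃ (θ : Fin h → HeadParams d m) (WO : Fin h → Matrix (Fin m) (Fin d) ℝ)
      (φ : FeedForwardParams d r),
    T = fun X => feedForward φ (multiHead (fun a => standardAttention e (θ a)) WO X)}

/-- Prime transformer blocks: the same blocks with every head replaced by a prime attention head
that has its own primer. -/
def primeBlocks (n d : ℕ) {m : ℕ} (e : Score m) (h r : ℕ) :
    Set (TokenSeq n d → TokenSeq n d) :=
  {T | ∃ (θ : Fin h → HeadParams d m) (F : Fin h → Primer n m)
      (WO : Fin h → Matrix (Fin m) (Fin d) ℝ) (φ : FeedForwardParams d r),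
    T = fun X => feedForward φ (multiHead (fun a => primeAttention e (θ a) (F a)) WO X)}

/-- Finite compositions of maps from `S`. -/
inductive IsComposition {V : Type} (S : Set (V → V)) : (V → V) → Prop
  | id : IsComposition S (fun x => x)
  | comp {T g : V → V} : T ∈ S → IsComposition S g → IsComposition S (fun x => T (g x))

/-- Standard transformers (of arbitrary depth). -/
def standardTransformers (n d : ℕ) {m : ℕ} (e : Score m) (h r : ℕ) :
    Set (TokenSeq n d → TokenSeq n d) :=
  {g | IsComposition (standardBlocks n d e h r) g}

/-- Prime-attention transformers (of arbitrary depth). -/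
def primeTransformers (n d : ℕ) {m : ℕ} (e : Score m) (h r : ℕ) :
    Set (TokenSeq n d → TokenSeq n d) :=
  {g | IsComposition (primeBlocks n d e h r) g}

/-- The class obtained from `𝒯` by adding a trainable positional encoding to the input. -/
def withPositionalEncoding {n d : ℕ} (𝒯 : Set (TokenSeq n d → TokenSeq n d)) :
    Set (TokenSeq n d → TokenSeq n d) :=
  {g | ∃ (E : TokenSeq n d) (T : TokenSeq n d → TokenSeq n d), T ∈ 𝒯 ∧ g = fun X => T (X + E)}

/-- The `L^p` distance on `D`,
`(∫_D ‖f(X) - g(X)‖_p^p dX)^(1/p)` with the entrywise `p`-norm and Lebesgue measure. -/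
def lpDist {n d n' : ℕ} (p : ℝ) (D : Set (TokenSeq n d)) (f g : TokenSeq n d → TokenSeq n' d) :
    ℝ≥0∞ :=
  (∫⁻ X in D, ∑ i, ∑ k, ‖f X i k - g X i k‖ₑ ^ p) ^ (1 / p)

/-- Append zero tokens to a sequence of `n` tokens so as to get `N` tokens (used for `n ≤ N`). -/
def padTokens {n d : ℕ} (N : ℕ) (X : TokenSeq n d) : TokenSeq N d :=
  fun i => if hi : (i : ℕ) < n then X ⟨i, hi⟩ else 0

/-- The first `n'` tokens of a sequence of `N` tokens. -/
def firstTokens {N d n' : ℕ} (hN : n' ≤ N) (Y : TokenSeq N d) : TokenSeq n' d :=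
  fun i => Y (Fin.castLE hN i)

end PrimeAttention

end

namespace PrimeAttention

/-! Unit primers give the inclusions, but the approximation does not use them, because nothing is
known about the score `e`. Zero query and key matrices make every score `e 0 0`, so softmax is
uniform, and the primers on the values turn a head into an arbitrary linear mixing of positions
(`mixing_mem_continuousPrimeTransformers`). Feed-forward layers supply piecewise linear ridge
updates (`ridge_mem_continuousPrimeTransformers`). Both are continuous whatever `e` is, and they
suffice.

The approximant rounds the input to a fine grid and then interpolates `f` on the finitely many
rounded inputs. For `exists_interpolation`, each token is encoded as a scalar, and a generic matrix
mixes the scalars so that each resulting value determines both the sequence and the position; a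
token-wise map then decodes. Position enters through the primers, so the positional encoding can be
zero.

Rounding is discontinuous and is realized only off thin gaps (`exists_quantizers`). As the gaps
shrink, each point eventually leaves them, and dominated convergence gives the `L^p` bound. -/

theorem primeAttention_one {n d m : ℕ} (e : Score m) (θ : HeadParams d m) :
    primeAttention e θ (fun (_ _ : Fin n) _ => 1) = standardAttention e θ := by
  have h (v : Fin m → ℝ) : (v * fun _ => 1) = v := mul_one v
  funext X i
  simp only [primeAttention, standardAttention, h]

theorem IsComposition.mono {V : Type} {S T : Set (V → V)} (hST : S ⊆ T) {g : V → V}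
    (hg : IsComposition S g) : IsComposition T g := by
  induction hg with
  | id => exact .id
  | comp hT _ ih => exact .comp (hST hT) ih

theorem IsComposition.trans {V : Type} {S : Set (V → V)} {f g : V → V}
    (hf : IsComposition S f) (hg : IsComposition S g) : IsComposition S (f ∘ g) := by
  induction hf with
  | id => exact hg
  | comp hT _ ih => exact (IsComposition.comp hT ih :)

theorem standardBlocks_subset_primeBlocks (n d : ℕ) {m : ℕ} (e : Score m) (h r : ℕ) :
    standardBlocks n d e h r ⊆ primeBlocks n d e h r := by
  rintro _ ⟨θ, WO, φ, rfl⟩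
  exact ⟨θ, fun _ _ _ _ => 1, WO, φ, by simp only [primeAttention_one]⟩

theorem standardTransformers_subset_primeTransformers (n d : ℕ) {m : ℕ} (e : Score m)
    (h r : ℕ) : standardTransformers n d e h r ⊆ primeTransformers n d e h r :=
  fun _ hg => IsComposition.mono (standardBlocks_subset_primeBlocks n d e h r) hg

theorem withPositionalEncoding_mono {n d : ℕ} {S T : Set (TokenSeq n d → TokenSeq n d)}
    (hST : S ⊆ T) : withPositionalEncoding S ⊆ withPositionalEncoding T := by
  rintro _ ⟨E, g, hg, rfl⟩
  exact ⟨E, g, hST hg, rfl⟩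

/-! ### Elementary blocks: ridge updates and linear mixing -/

/-- The prime transformers that are continuous maps. -/
def continuousPrimeTransformers (n d : ℕ) {m : ℕ} (e : Score m) (h r : ℕ) :
    Set (TokenSeq n d → TokenSeq n d) :=
  {g | g ∈ primeTransformers n d e h r ∧ Continuous g}

/-- Continuous piecewise linear functions with at most four kinks. -/
def fourKinkFunctions : Set (ℝ → ℝ) :=
  {φ | ∃ (β γ : Fin 4 → ℝ) (c : ℝ), φ = fun z => ∑ a, γ a * max (z + β a) 0 + c}

theorem continuous_of_mem_fourKinkFunctions {φ : ℝ → ℝ} (hφ : φ ∈ fourKinkFunctions) :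
    Continuous φ := by
  obtain ⟨β, γ, c, rfl⟩ := hφ
  fun_prop

section Blocks

variable {n d m : ℕ} {e : Score m} {h r : ℕ}

theorem id_mem_continuousPrimeTransformers :
    (fun X => X) ∈ continuousPrimeTransformers n d e h r :=
  ⟨.id, continuous_id⟩

theorem comp_mem_continuousPrimeTransformers {f g : TokenSeq n d → TokenSeq n d}
    (hf : f ∈ continuousPrimeTransformers n d e h r)
    (hg : g ∈ continuousPrimeTransformers n d e h r) :
    f ∘ g ∈ continuousPrimeTransformers n d e h r :=
  ⟨hf.1.trans hg.1, hf.2.comp hg.2⟩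

theorem primeBlock_mem_primeTransformers {T : TokenSeq n d → TokenSeq n d}
    (hT : T ∈ primeBlocks n d e h r) : T ∈ primeTransformers n d e h r :=
  .comp hT .id

/-- A token-wise ridge update by a piecewise linear function is a prime transformer. -/
theorem ridge_mem_continuousPrimeTransformers (hr : 4 ≤ r) {φ : ℝ → ℝ}
    (hφ : φ ∈ fourKinkFunctions) (w v : Fin d → ℝ) :
    (fun (X : TokenSeq n d) i => X i + φ (X i ⬝ᵥ w) • v) ∈
      continuousPrimeTransformers n d e h r := by
  have hc := continuous_of_mem_fourKinkFunctions hφ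
  refine ⟨primeBlock_mem_primeTransformers ?_, ?_⟩
  · obtain ⟨s, rfl⟩ := Nat.exists_eq_add_of_le hr
    obtain ⟨β, γ, c, rfl⟩ := hφ
    -- Zero output matrices leave only the residual in the attention layer; hidden units beyond the
    -- fourth get zero output weights.
    refine ⟨fun _ => ⟨0, 0, 0⟩, fun _ _ _ _ => 0, fun _ => 0,
      ⟨Matrix.of fun k _ => w k, Fin.append β 0,
        Matrix.of (Fin.append (fun a => γ a • v) 0), c • v⟩, ?_⟩
    funext X i
    have hw (a : Fin (4 + s)) : (X i ᵥ* (Matrix.of fun k _ => w k)) a = X i ⬝ᵥ w := rfl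
    have hm : multiHead (fun a : Fin h => primeAttention e (⟨0, 0, 0⟩ : HeadParams d m)
        (fun _ _ _ => 0)) (fun _ => 0) X = X := by
      funext i
      simp [multiHead]
    ext k
    simp only [feedForward, hm, Pi.add_apply, hw]
    simp only [Matrix.vecMul, dotProduct]
    rw [Fin.sum_univ_add]
    simp only [Fin.append_left, Fin.append_right, Matrix.of_apply, Pi.smul_apply, smul_eq_mul,
      Pi.zero_apply, mul_zero, Finset.sum_const_zero, add_zero, add_mul, Finset.sum_mul]
    congr 2
    exact Finset.sum_congr rfl fun a _ => by ring
  · have : Continuous fun X : TokenSeq n d => X := continuous_id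
    simp only [dotProduct]
    fun_prop

/-- Arbitrary linear mixing of one coordinate across the tokens is a prime transformer. -/
theorem mixing_mem_continuousPrimeTransformers (hh : 1 ≤ h) (hm : 1 ≤ m) (k₀ : Fin d)
    (A : Fin n → Fin n → ℝ) :
    (fun (X : TokenSeq n d) i => X i + Pi.single k₀ (∑ j, A i j * X j k₀)) ∈
      continuousPrimeTransformers n d e h r := by
  refine ⟨primeBlock_mem_primeTransformers ?_, ?_⟩
  · let l₀ : Fin m := ⟨0, hm⟩
    let a₀ : Fin h := ⟨0, hh⟩
    -- Keys stay zero after multiplication by the primer, so all weights are `1/n`; the factor `n`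
    -- in the primer cancels this. Only head `a₀` reaches the output.
    refine ⟨fun _ => ⟨0, 0, Matrix.single k₀ l₀ 1⟩, fun _ i j _ => n * A i j,
      fun a => if a = a₀ then Matrix.single l₀ k₀ 1 else 0, ⟨0, 0, 0, 0⟩, ?_⟩
    funext X i
    have hn : (n : ℝ) ≠ 0 := by
      have := i.pos
      positivity
    have hs (j : Fin n) (u : Fin n → ℝ) (hu : ∀ l, u l = u i) :
        softmax u j = (n : ℝ)⁻¹ := by
      have := Real.exp_ne_zero (u i)
      simp only [softmax, hu, Finset.sum_const, Finset.card_univ, Fintype.card_fin, nsmul_eq_mul]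
      field_simp
    have hp : primeAttention e (⟨0, 0, Matrix.single k₀ l₀ 1⟩ : HeadParams d m)
        (fun i j _ => n * A i j) X i l₀ = ∑ j, A i j * X j k₀ := by
      simp only [primeAttention, Finset.sum_apply, Pi.smul_apply, Pi.mul_apply, smul_eq_mul]
      refine Finset.sum_congr rfl fun j _ => ?_
      rw [hs j _ fun l => by simp]
      simp [Matrix.vecMul, dotProduct, Matrix.single_apply]
      field_simp
    simp only [feedForward, multiHead]
    rw [Finset.sum_eq_single a₀ (by intro b _ hb; simp [hb]) (by simp)]
    ext k
    simp only [← hp]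
    by_cases hk : k = k₀
    · simp [Matrix.vecMul, dotProduct, Matrix.single_apply, hk, eq_comm]
    · simp [Matrix.vecMul, dotProduct, hk, Ne.symm hk]
  · simp only [Pi.single]
    refine continuous_pi fun i => continuous_pi fun k => ?_
    by_cases hk : k = k₀ <;> simp [Function.update, hk] <;> fun_prop

end Blocks


/-! ### Separating functionals and bumps -/

/-- Each vector of `S` excludes a proper hyperplane of functionals, and finitely many of these
cannot cover the dual over an infinite field. -/
theorem exists_dotProduct_ne_zero {ι : Type*} [Fintype ι] (S : Finset (ι → ℝ))
    (hS : (0 : ι → ℝ) ∉ S) : ∃ w : ι → ℝ, ∀ v ∈ S, v ⬝ᵥ w ≠ 0 := by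
  classical
  obtain ⟨f, hf⟩ := Module.exists_dual_forall_apply_ne_zero (K := ℝ) (fun v : S => (v : ι → ℝ))
    fun v h => hS (h ▸ v.2)
  refine ⟨fun k => f (Pi.single k 1), fun v hv => ?_⟩
  convert hf ⟨v, hv⟩ using 1
  rw [LinearMap.pi_apply_eq_sum_univ f v]
  refine Finset.sum_congr rfl fun k _ => ?_
  rw [smul_eq_mul]
  refine congrArg (fun z => v k * f z) (funext fun l => ?_)
  simp [Pi.single_apply, eq_comm]

/-- A linear functional separating finitely many points, and not vanishing on a given nonzero
vector. -/
theorem exists_injOn_dotProduct {ι : Type*} [Fintype ι] (P : Finset (ι → ℝ)) (u : ι → ℝ)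
    (hu : u ≠ 0) : ∃ w : ι → ℝ, Set.InjOn (fun p => p ⬝ᵥ w) P ∧ u ⬝ᵥ w ≠ 0 := by
  classical
  obtain ⟨w, hw⟩ := exists_dotProduct_ne_zero
    (insert u (((P ×ˢ P).filter fun q => q.1 ≠ q.2).image fun q => q.1 - q.2)) (by
      simp only [Finset.mem_insert, Finset.mem_image, Finset.mem_filter, not_or, not_exists]
      exact ⟨hu.symm, fun q hq => hq.1.2 (sub_eq_zero.1 hq.2)⟩)
  refine ⟨w, fun p hp q hq hpq => ?_, hw u (by simp)⟩
  by_contra hne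
  refine hw (p - q) (Finset.mem_insert_of_mem (Finset.mem_image.2 ⟨(p, q), ?_, rfl⟩)) ?_
  · simpa [hne] using ⟨hp, hq⟩
  · rw [sub_dotProduct]
    exact sub_eq_zero.2 hpq

theorem const_mem_fourKinkFunctions (c : ℝ) : (fun _ => c) ∈ fourKinkFunctions :=
  ⟨0, 0, c, by simp⟩

/-- A piecewise linear bump at `z` that vanishes on a given finite set. -/
theorem exists_bump (Z : Finset ℝ) {z : ℝ} (hz : z ∉ Z) :
    ∃ φ ∈ fourKinkFunctions, φ z = 1 ∧ ∀ y ∈ Z, φ y = 0 := by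
  obtain ⟨δ, hδ, hball⟩ := Metric.isOpen_iff.1 Z.finite_toSet.isClosed.isOpen_compl z (by simpa)
  -- The hat of height 1 on `[z - δ, z + δ]` has three kinks; the fourth coefficient is zero.
  refine ⟨fun y => ∑ a, ![1 / δ, -2 / δ, 1 / δ, 0] a * max (y + ![-z + δ, -z, -z - δ, 0] a) 0 + 0,
    ⟨_, _, 0, rfl⟩, ?_, fun y hy => ?_⟩
  · have : z + (-z - δ) ≤ 0 := by linarith
    simp [Fin.sum_univ_four, hδ.le, hδ.ne', this]
  · have : δ ≤ |y - z| := by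
      by_contra h
      exact hball (show y ∈ Metric.ball z δ by simpa [Real.dist_eq] using h) hy
    simp only [Fin.sum_univ_four, Matrix.cons_val]
    rcases le_abs.1 this with h | h
    · rw [max_eq_left (by linarith), max_eq_left (by linarith), max_eq_left (by linarith)]
      ring
    · rw [max_eq_right (by linarith), max_eq_right (by linarith), max_eq_right (by linarith)]
      ring

/-! ### Exact interpolation on finitely many sequences -/

section Interpolation

variable {n d m : ℕ} {e : Score m} {h r : ℕ}

/-- Token-wise interpolation when the targets avoid the values of the separating functional. -/
theorem exists_tokenwise_interpolation_of_disjoint (hr : 4 ≤ r) (P S : Finset (Fin d → ℝ))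
    (hSP : S ⊆ P) (t : (Fin d → ℝ) → Fin d → ℝ) (w : Fin d → ℝ)
    (hw : Set.InjOn (fun p => p ⬝ᵥ w) P) (ht : ∀ p ∈ P, ∀ q ∈ P, p ⬝ᵥ w ≠ t q ⬝ᵥ w) :
    ∃ G : (Fin d → ℝ) → Fin d → ℝ, (∀ p ∈ S, G p = t p) ∧ (∀ p ∈ P, p ∉ S → G p = p) ∧
      (fun (X : TokenSeq n d) i => G (X i)) ∈ continuousPrimeTransformers n d e h r := by
  classical
  induction S using Finset.induction_on with
  | empty => exact ⟨id, by simp, by simp, id_mem_continuousPrimeTransformers⟩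
  | insert a S ha ih =>
    obtain ⟨G, hGS, hGP, hG⟩ := ih ((Finset.subset_insert a S).trans hSP)
    have haP : a ∈ P := hSP (Finset.mem_insert_self a S)
    -- Moving `a` to `t a` must disturb neither the points still waiting nor those already at their
    -- targets, so the bump vanishes at the values of both.
    obtain ⟨φ, hφ, hφa, hφ0⟩ := exists_bump
      ((P.erase a).image (fun p => p ⬝ᵥ w) ∪ P.image fun p => t p ⬝ᵥ w) (z := a ⬝ᵥ w) (by
        simp only [Finset.mem_union, Finset.mem_image, Finset.mem_erase, not_or, not_exists]
        exact ⟨fun p hp => hp.1.1 (hw hp.1.2 haP hp.2), fun p hp => ht a haP p hp.1 hp.2.symm⟩)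
    refine ⟨fun x => G x + φ (G x ⬝ᵥ w) • (t a - a), fun p hp => ?_, fun p hp hpS => ?_,
      comp_mem_continuousPrimeTransformers
        (ridge_mem_continuousPrimeTransformers hr hφ w (t a - a)) hG⟩
    · by_cases hpa : p = a
      · subst hpa
        simp [hGP p haP ha, hφa]
      · have hpS : p ∈ S := Finset.mem_of_mem_insert_of_ne hp hpa
        have h0 := hφ0 (t p ⬝ᵥ w) (Finset.mem_union_right _ (Finset.mem_image.2
          ⟨p, hSP (Finset.mem_insert_of_mem hpS), rfl⟩))
        simp [hGS p hpS, h0]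
    · rw [Finset.mem_insert, not_or] at hpS
      have h0 := hφ0 (p ⬝ᵥ w) (Finset.mem_union_left _ (Finset.mem_image.2
        ⟨p, Finset.mem_erase.2 ⟨hpS.1, hp⟩, rfl⟩))
      simp [hGP p hp hpS.2, h0]

/-- Finitely many token values can be sent to arbitrary targets, token by token. -/
theorem exists_tokenwise_interpolation (hr : 4 ≤ r) (k₀ : Fin d) (P : Finset (Fin d → ℝ))
    (t : (Fin d → ℝ) → Fin d → ℝ) :
    ∃ G : (Fin d → ℝ) → Fin d → ℝ, (∀ p ∈ P, G p = t p) ∧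
      (fun (X : TokenSeq n d) i => G (X i)) ∈ continuousPrimeTransformers n d e h r := by
  classical
  set u : Fin d → ℝ := Pi.single k₀ 1 with hu
  obtain ⟨w, hw, hwu⟩ := exists_injOn_dotProduct P u (by simp [hu])
  -- All points are first translated by `c • u`; the excluded values of `c` are those at which a
  -- translated point and a target agree under `w`.
  obtain ⟨c, hc⟩ := Infinite.exists_notMem_finset
    ((P ×ˢ P).image fun q => (t q.2 ⬝ᵥ w - q.1 ⬝ᵥ w) / (u ⬝ᵥ w))
  obtain ⟨G, hG, -, hGm⟩ := exists_tokenwise_interpolation_of_disjoint (n := n) (e := e) (h := h)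
    hr (P.image fun p => p + c • u) _ subset_rfl (fun p => t (p - c • u)) w (by
      rintro _ hp _ hq hpq
      simp only [Finset.coe_image, Set.mem_image] at hp hq
      obtain ⟨p, hp, rfl⟩ := hp
      obtain ⟨q, hq, rfl⟩ := hq
      simp only [add_dotProduct, add_left_inj] at hpq
      rw [hw hp hq hpq]) (by
      simp only [Finset.mem_image]
      rintro _ ⟨p, hp, rfl⟩ _ ⟨q, hq, rfl⟩ hpq
      refine hc (Finset.mem_image.2 ⟨(p, q), Finset.mem_product.2 ⟨hp, hq⟩, ?_⟩)
      simp only [add_dotProduct, smul_dotProduct, smul_eq_mul, add_sub_cancel_right] at hpq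
      rw [div_eq_iff hwu]
      linarith)
  refine ⟨fun x => G (x + c • u), fun p hp => ?_, comp_mem_continuousPrimeTransformers hGm
    (ridge_mem_continuousPrimeTransformers hr (const_mem_fourKinkFunctions c) 0 u)⟩
  simpa using hG _ (Finset.mem_image_of_mem _ hp)

/-- A matrix whose rows send finitely many distinct nonzero vectors to distinct numbers. -/
theorem exists_injOn_sum_mul (S : Finset (Fin n → ℝ)) (hS : (0 : Fin n → ℝ) ∉ S) :
    ∃ A : Fin n → Fin n → ℝ, ∀ s ∈ S, ∀ s' ∈ S, ∀ i i', ∑ j, A i j * s j = ∑ j, A i' j * s' j →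
      s = s' ∧ i = i' := by
  classical
  -- `F s i` is the array with `s` in row `i` and zeros elsewhere, so pairing with `w` computes row
  -- `i` of the matrix `w` applied to `s`. A functional separating these arrays is the required
  -- matrix; `s ≠ 0` makes the row recoverable.
  let F (s : Fin n → ℝ) (i : Fin n) : Fin n × Fin n → ℝ := fun q => if q.1 = i then s q.2 else 0
  have hF (s i) (w : Fin n × Fin n → ℝ) : F s i ⬝ᵥ w = ∑ j, w (i, j) * s j := by
    simp only [dotProduct, Fintype.sum_prod_type, F, ite_mul, zero_mul]
    rw [Finset.sum_comm]
    simp [mul_comm]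
  let P := (S ×ˢ Finset.univ).image fun q => F q.1 q.2
  by_cases hn : Nonempty (Fin n)
  · obtain ⟨i₀⟩ := hn
    obtain ⟨w, hw, -⟩ := exists_injOn_dotProduct P (Pi.single (i₀, i₀) 1) (by simp)
    have hP {s i} (hs : s ∈ S) : F s i ∈ (P : Set (Fin n × Fin n → ℝ)) :=
      Finset.mem_coe.2 (Finset.mem_image.2 ⟨(s, i), by simpa using hs, rfl⟩)
    refine ⟨fun i j => w (i, j), fun s hs s' hs' i i' heq => ?_⟩
    rw [← hF, ← hF] at heq
    have hFF := hw (hP hs) (hP hs') heq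
    have hii : i = i' := by
      by_contra hne
      refine hS ?_
      convert hs
      ext j
      simpa [F, hne] using (congrFun hFF (i, j)).symm
    subst hii
    exact ⟨funext fun j => by simpa [F] using congrFun hFF (i, j), rfl⟩
  · exact ⟨0, fun s _ s' _ i => (hn ⟨i⟩).elim⟩

/-- Finitely many sequences can be sent to arbitrary targets. -/
theorem exists_interpolation (hh : 1 ≤ h) (hm : 1 ≤ m) (hr : 4 ≤ r)
    (C : Finset (TokenSeq n d)) (t : TokenSeq n d → TokenSeq n d) :
    ∃ g ∈ continuousPrimeTransformers n d e h r, ∀ x ∈ C, g x = t x := by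
  classical
  rcases isEmpty_or_nonempty (Fin n) with hn | ⟨⟨i₀⟩⟩
  · exact ⟨_, id_mem_continuousPrimeTransformers, fun x _ => Subsingleton.elim _ _⟩
  rcases isEmpty_or_nonempty (Fin d) with hd | ⟨⟨k₀⟩⟩
  · exact ⟨_, id_mem_continuousPrimeTransformers, fun x _ => Subsingleton.elim _ _⟩
  let P : Finset (Fin d → ℝ) := (C ×ˢ Finset.univ).image fun q => q.1 q.2
  have hP {x i} (hx : x ∈ C) : x i ∈ P := Finset.mem_image.2 ⟨(x, i), by simpa using hx, rfl⟩
  obtain ⟨w, hw, -⟩ := exists_injOn_dotProduct P (Pi.single k₀ 1) (by simp)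
  -- The offset keeps all codes nonzero, without which mixing could not distinguish positions.
  obtain ⟨c, hc⟩ := Infinite.exists_notMem_finset (P.image fun p => -(p ⬝ᵥ w))
  obtain ⟨G₁, hG₁, hG₁m⟩ := exists_tokenwise_interpolation (n := n) (e := e) (h := h) hr k₀ P
    fun p => Pi.single k₀ (p ⬝ᵥ w + c)
  let code (x : TokenSeq n d) : Fin n → ℝ := fun i => x i ⬝ᵥ w + c
  obtain ⟨A, hA⟩ := exists_injOn_sum_mul (C.image code) (by
    rw [Finset.mem_image]
    rintro ⟨x, hx, h0⟩
    refine hc (Finset.mem_image.2 ⟨x i₀, hP hx, ?_⟩)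
    have : x i₀ ⬝ᵥ w + c = 0 := congrFun h0 i₀
    linarith)
  -- The token at position `q.2` after encoding and mixing; injectivity lets a token-wise map decode
  -- it.
  let y (q : TokenSeq n d × Fin n) : Fin d → ℝ := Pi.single k₀ (∑ j, A q.2 j * code q.1 j)
  have hy : Set.InjOn y (C ×ˢ (Finset.univ : Finset (Fin n)) : Finset _) := by
    rintro ⟨x, i⟩ hx ⟨x', i'⟩ hx' heq
    simp only [Finset.coe_product, Set.mem_prod, Finset.mem_coe, Finset.coe_univ, Set.mem_univ,
      and_true] at hx hx'
    obtain ⟨h1, h2⟩ := hA _ (Finset.mem_image_of_mem _ hx) _ (Finset.mem_image_of_mem _ hx') i i'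
      (by simpa [y] using congrFun heq k₀)
    refine Prod.ext (funext fun j => hw (hP hx) (hP hx') ?_) h2
    exact add_right_cancel (congrFun h1 j)
  have : Nonempty (TokenSeq n d × Fin n) := ⟨0, i₀⟩
  let inv := Function.invFunOn y (C ×ˢ (Finset.univ : Finset (Fin n)) : Finset _)
  obtain ⟨G₂, hG₂, hG₂m⟩ := exists_tokenwise_interpolation (n := n) (e := e) (h := h) hr k₀
    ((C ×ˢ Finset.univ).image y) fun z => t (inv z).1 (inv z).2
  -- Subtracting the identity from `A` cancels the residual connection.
  refine ⟨_, comp_mem_continuousPrimeTransformers hG₂m (comp_mem_continuousPrimeTransformers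
    (mixing_mem_continuousPrimeTransformers hh hm k₀ fun i j => A i j - if i = j then 1 else 0)
    hG₁m), fun x hx => funext fun i => ?_⟩
  have hmem : (x, i) ∈ C ×ˢ (Finset.univ : Finset (Fin n)) := by simpa using hx
  have h1 : inv (y (x, i)) = (x, i) := hy.leftInvOn_invFunOn (Finset.mem_coe.2 hmem)
  have h2 := hG₂ (y (x, i)) (Finset.mem_image_of_mem _ hmem)
  simp only [h1] at h2
  rw [← h2]
  simp only [Function.comp_apply, hG₁ _ (hP hx)]
  congr 1
  simp [y, code, sub_mul, Finset.sum_sub_distrib, ← Pi.single_add]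

end Interpolation


/-! ### Approximate rounding to a grid -/

/-- A piecewise linear map that collapses most of the cell `[a, a + s]` to `a` and fixes everything
outside the cell. -/
theorem exists_cell_collapse (a : ℝ) {s η : ℝ} (hη : 0 < η) (hηs : η ≤ s) :
    ∃ φ ∈ fourKinkFunctions, (∀ y ≤ a, φ y = 0) ∧ (∀ y, a ≤ y → y ≤ a + s - η → y + φ y = a) ∧
      (∀ y, a + s ≤ y → φ y = 0) ∧ ∀ y, a ≤ y → a ≤ y + φ y ∧ φ y ≤ 0 := by
  -- The coefficients give `y + φ y` slope 0 up to `a + s - η`, slope `s / η` on the remaining gap,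
  -- and slope 1 beyond the cell.
  let φ : ℝ → ℝ := fun y => ∑ b, ![-1, s / η, -((s - η) / η), 0] b *
    max (y + ![-a, -(a + s - η), -(a + s), 0] b) 0 + 0
  have hs : (s - η) / η = s / η - 1 := by field_simp
  have hsη : s / η * η = s := by field_simp
  have hφ (y : ℝ) : φ y = -max (y - a) 0 + s / η * max (y - (a + s - η)) 0 -
      (s / η - 1) * max (y - (a + s)) 0 := by
    simp only [φ, hs, Fin.sum_univ_four, Matrix.cons_val, ← sub_eq_add_neg]
    ring
  have h1 (y : ℝ) (hy : y ≤ a) : φ y = 0 := by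
    rw [hφ, max_eq_right (by linarith), max_eq_right (by linarith), max_eq_right (by linarith)]
    ring
  have h2 (y : ℝ) (hy : a ≤ y) (hy' : y ≤ a + s - η) : y + φ y = a := by
    rw [hφ, max_eq_left (by linarith), max_eq_right (by linarith), max_eq_right (by linarith)]
    ring
  have h3 (y : ℝ) (hy : a + s ≤ y) : φ y = 0 := by
    rw [hφ, max_eq_left (by linarith), max_eq_left (by linarith), max_eq_left (by linarith)]
    linear_combination hsη
  refine ⟨φ, ⟨_, _, 0, rfl⟩, h1, h2, h3, fun y hy => ?_⟩
  rcases le_total y (a + s - η) with h | h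
  · have := h2 y hy h
    constructor <;> linarith
  rcases le_total (a + s) y with h' | h'
  · rw [h3 y h']
    constructor <;> linarith
  rw [hφ, max_eq_left (by linarith), max_eq_left (by linarith), max_eq_right (by linarith)]
  have h0 : 1 ≤ s / η := (one_le_div hη).2 hηs
  constructor
  · have := mul_nonneg (zero_le_one.trans h0) (sub_nonneg.2 h)
    linarith
  · have := mul_nonneg (sub_nonneg.2 h0) (sub_nonneg.2 h')
    nlinarith

section Quantizer

variable {n d m : ℕ} {e : Score m} {h r : ℕ}

/-- Ridge updates along basis vectors read and write a single coordinate, so they can be composed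
one coordinate at a time. -/
theorem coordinatewise_mem_continuousPrimeTransformers (hr : 4 ≤ r) {φ : ℝ → ℝ}
    (hφ : φ ∈ fourKinkFunctions) :
    (fun (X : TokenSeq n d) i k => X i k + φ (X i k)) ∈
      continuousPrimeTransformers n d e h r := by
  classical
  suffices H : ∀ K : Finset (Fin d), (fun (X : TokenSeq n d) i k =>
      if k ∈ K then X i k + φ (X i k) else X i k) ∈ continuousPrimeTransformers n d e h r by
    simpa using H Finset.univ
  intro K
  induction K using Finset.induction_on with
  | empty => simpa using id_mem_continuousPrimeTransformers
  | insert a K ha ih =>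
    convert comp_mem_continuousPrimeTransformers
      (ridge_mem_continuousPrimeTransformers hr hφ (Pi.single a 1) (Pi.single a 1)) ih using 1
    funext X i k
    by_cases hk : k = a
    · subst hk
      simp [ha]
    · simp [hk]

/-- Coordinatewise prime transformers that collapse most of each of `M` consecutive cells. -/
theorem exists_cells_collapse (hr : 4 ≤ r) (a : ℝ) {s η : ℝ} (hη : 0 < η) (hηs : η ≤ s) (M : ℕ) :
    ∃ ψ : ℝ → ℝ, (fun (X : TokenSeq n d) i k => ψ (X i k)) ∈ continuousPrimeTransformers n d e h r ∧
      (∀ j : ℕ, j < M → ∀ y, a + j * s ≤ y → y ≤ a + j * s + s - η → ψ y = a + j * s) ∧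
      (∀ y, a + M * s ≤ y → ψ y = y) ∧ ∀ y, a ≤ y → a ≤ ψ y ∧ ψ y ≤ y := by
  have hs : 0 < s := hη.trans_le hηs
  induction M with
  | zero => exact ⟨fun y => y, id_mem_continuousPrimeTransformers, by simp, by simp, by simp⟩
  | succ M ih =>
    obtain ⟨ψ, hψ, hψ1, hψ2, hψ3⟩ := ih
    obtain ⟨φ, hφ, hφ1, hφ2, hφ3, hφ4⟩ := exists_cell_collapse (a + M * s) hη hηs
    -- Cells are treated from left to right: earlier values lie at or below `a + M * s`, where `φ`
    -- vanishes, and points of the new cell have not moved yet.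
    refine ⟨fun y => ψ y + φ (ψ y), comp_mem_continuousPrimeTransformers
      (coordinatewise_mem_continuousPrimeTransformers hr hφ) hψ, fun j hj y hy hy' => ?_,
      fun y hy => ?_, fun y hy => ?_⟩ <;> beta_reduce
    · rcases Nat.lt_succ_iff_lt_or_eq.1 hj with hjM | rfl
      · have : (j : ℝ) * s ≤ M * s := by gcongr
        rw [hψ1 j hjM y hy hy', hφ1 _ (by linarith), add_zero]
      · rw [hψ2 y hy, hφ2 y hy hy']
    · push_cast at hy
      rw [hψ2 y (by linarith), hφ3 y (by linarith), add_zero]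
    · obtain ⟨h1, h2⟩ := hψ3 y hy
      rcases le_total (ψ y) (a + M * s) with h3 | h3
      · rw [hφ1 _ h3]
        constructor <;> linarith
      · have : 0 ≤ M * s := by positivity
        obtain ⟨h4, h5⟩ := hφ4 _ h3
        constructor <;> linarith

/-- Coordinatewise prime transformers that converge to rounding down to a grid of step `s`, in the
sense that their values at each point are eventually the rounded ones. -/
theorem exists_quantizers (hr : 4 ≤ r) (a : ℝ) {s : ℝ} (hs : 0 < s) (M : ℕ) :
    ∃ ψ : ℕ → ℝ → ℝ,
      (∀ t, (fun (X : TokenSeq n d) i k => ψ t (X i k)) ∈ continuousPrimeTransformers n d e h r) ∧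
      (∀ t y, a ≤ y → a ≤ ψ t y ∧ ψ t y ≤ y) ∧
      ∀ y, a ≤ y → y < a + M * s → ∀ᶠ t in Filter.atTop, ψ t y = a + ⌊(y - a) / s⌋₊ * s := by
  -- The gap widths `s / (t + 1)` tend to zero, and the cell of `y` is half-open, so `y` is at
  -- positive distance from its right end.
  have hη (t : ℕ) : 0 < s / (t + 1) := by positivity
  have hηs (t : ℕ) : s / (t + 1) ≤ s := div_le_self hs.le (by simp)
  choose ψ hψ hψ1 hψ2 hψ3 using fun t : ℕ =>
    exists_cells_collapse (n := n) (d := d) (e := e) (h := h) hr a (hη t) (hηs t) M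
  refine ⟨ψ, hψ, hψ3, fun y hy hyM => ?_⟩
  have h0 : 0 ≤ (y - a) / s := div_nonneg (by linarith) hs.le
  have h1 := Nat.floor_le h0
  have h2 := Nat.lt_floor_add_one ((y - a) / s)
  have h3 : ⌊(y - a) / s⌋₊ < M := (Nat.floor_lt h0).2 (by rw [div_lt_iff₀ hs]; linarith)
  rw [le_div_iff₀ hs] at h1
  rw [div_lt_iff₀ hs] at h2
  have hlim : Filter.Tendsto (fun t : ℕ => s / ((t : ℝ) + 1)) Filter.atTop (nhds 0) := by
    simpa [div_eq_mul_inv] using (tendsto_one_div_add_atTop_nhds_zero_nat (𝕜 := ℝ)).const_mul s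
  filter_upwards [hlim.eventually_lt_const
    (show 0 < a + ⌊(y - a) / s⌋₊ * s + s - y by linarith)] with t ht
  exact hψ1 t _ h3 y (by linarith) (by linarith)

end Quantizer


/-! ### Approximation in `L^p` on padded sequences -/

theorem padTokens_apply_mem {n d N : ℕ} {S : Set ℝ} (h0 : 0 ∈ S) {X : TokenSeq n d}
    (hX : ∀ i k, X i k ∈ S) (i : Fin N) (k : Fin d) : padTokens N X i k ∈ S := by
  unfold padTokens
  split_ifs with hi
  exacts [hX _ _, h0]

theorem firstTokens_padTokens {n d N : ℕ} (hn : n ≤ N) (X : TokenSeq n d) :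
    firstTokens hn (padTokens N X) = X := by
  ext i k
  simp [firstTokens, padTokens]

theorem continuous_padTokens {n d : ℕ} (N : ℕ) :
    Continuous (padTokens N : TokenSeq n d → TokenSeq N d) := by
  refine continuous_pi fun i => ?_
  unfold padTokens
  split_ifs with hi <;> fun_prop

theorem continuous_firstTokens {n d N : ℕ} (hn : n ≤ N) :
    Continuous (firstTokens hn : TokenSeq N d → TokenSeq n d) := by
  unfold firstTokens
  fun_prop

/-- Rounding down to a grid of step `s` based at `a`, coordinate by coordinate. -/
noncomputable def gridRound {n d : ℕ} (a s : ℝ) (X : TokenSeq n d) : TokenSeq n d :=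
  fun i k => a + ⌊(X i k - a) / s⌋₊ * s

theorem abs_sub_le_of_floor_eq {a s x y : ℝ} (hs : 0 < s) (hx : a ≤ x) (hy : a ≤ y)
    (h : a + ⌊(x - a) / s⌋₊ * s = a + ⌊(y - a) / s⌋₊ * s) : |x - y| ≤ s := by
  have hx1 := Nat.floor_le (div_nonneg (sub_nonneg.2 hx) hs.le)
  have hx2 := (Nat.lt_floor_add_one ((x - a) / s)).le
  have hy1 := Nat.floor_le (div_nonneg (sub_nonneg.2 hy) hs.le)
  have hy2 := (Nat.lt_floor_add_one ((y - a) / s)).le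
  rw [le_div_iff₀ hs] at hx1 hy1
  rw [div_le_iff₀ hs] at hx2 hy2
  rw [abs_le]
  constructor <;> linarith

/-- The fibres of rounding have diameter at most `s`, so a uniformly continuous `f` is nearly
constant on each. -/
theorem dist_le_of_gridRound_padTokens_eq {n d N : ℕ} (hn : n ≤ N) {a s : ℝ} (hs : 0 < s)
    {X Y : TokenSeq n d} (hX : ∀ i k, a ≤ X i k) (hY : ∀ i k, a ≤ Y i k)
    (h : gridRound a s (padTokens N X) = gridRound a s (padTokens N Y)) : dist X Y ≤ s := by
  refine (dist_pi_le_iff hs.le).2 fun i => (dist_pi_le_iff hs.le).2 fun k => ?_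
  refine abs_sub_le_of_floor_eq hs (hX i k) (hY i k) ?_
  simpa [gridRound, padTokens] using congrFun (congrFun h (Fin.castLE hn i)) k

theorem finite_gridRound_image {n d : ℕ} {a b s : ℝ} (hs : 0 < s) :
    (gridRound a s '' {X : TokenSeq n d | ∀ i k, X i k ∈ Set.Icc a b}).Finite := by
  refine Set.Finite.subset (Set.Finite.pi' fun _ => Set.Finite.pi' fun _ =>
    ((Set.finite_Iic ⌊(b - a) / s⌋₊).image fun j : ℕ => a + j * s)) ?_
  rintro _ ⟨X, hX, rfl⟩ i k
  refine ⟨_, Nat.floor_mono ?_, rfl⟩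
  gcongr
  exact (hX i k).2

/-- Approximation of a continuous function by a function of the rounded input that is the
pointwise eventual value of a uniformly bounded sequence of continuous prime transformers. -/
theorem exists_eventually_eq_approx {n n' N d m : ℕ} (hn : n ≤ N) (hn' : n' ≤ N) (e : Score m)
    {h r : ℕ} (hh : 1 ≤ h) (hm : 1 ≤ m) (hr : 4 ≤ r) {D : Set (TokenSeq n d)} (hD : IsCompact D)
    {f : TokenSeq n d → TokenSeq n' d} (hf : ContinuousOn f D) {δ : ℝ} (hδ : 0 < δ) :
    ∃ (g : ℕ → TokenSeq N d → TokenSeq N d) (S : TokenSeq n d → TokenSeq n' d) (B : ℝ),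
      (∀ t, g t ∈ continuousPrimeTransformers N d e h r) ∧
      (∀ t, ∀ X ∈ D, dist (f X) (firstTokens hn' (g t (padTokens N X))) ≤ B) ∧
      (∀ X ∈ D, dist (f X) (S X) ≤ δ) ∧
      ∀ X ∈ D, ∀ᶠ t in Filter.atTop, firstTokens hn' (g t (padTokens N X)) = S X := by
  classical
  obtain ⟨b₀, hb₀⟩ := hD.isBounded.exists_norm_le
  -- Nonnegativity of `b` puts the padding zeros inside `[-b, b]`.
  set b := max b₀ 0 with hb
  have hb0 : 0 ≤ b := le_max_right _ _
  have hmem {X} (hX : X ∈ D) (i k) : X i k ∈ Set.Icc (-b) b :=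
    abs_le.1 ((norm_le_pi_norm (X i) k).trans ((norm_le_pi_norm X i).trans
      ((hb₀ X hX).trans (le_max_left _ _))))
  have hpad {X} (hX : X ∈ D) (i : Fin N) (k) : padTokens N X i k ∈ Set.Icc (-b) b :=
    padTokens_apply_mem (by simpa using hb0) (hmem hX) i k
  obtain ⟨s, hs, hfs⟩ := Metric.uniformContinuousOn_iff_le.1
    (hD.uniformContinuousOn_of_continuous hf) δ hδ
  let Q (X : TokenSeq n d) : TokenSeq N d := gridRound (-b) s (padTokens N X)
  have hQ : (Q '' D).Finite := (finite_gridRound_image (b := b) hs).subset (by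
    rintro _ ⟨X, hX, rfl⟩
    exact ⟨_, hpad hX, rfl⟩)
  -- Grid points may lie outside `D`, where `f` is uncontrolled, so each cell is represented by a
  -- point of `D`.
  have hrep : ∀ v, ∃ X, v ∈ Q '' D → X ∈ D ∧ Q X = v := fun v => by
    by_cases hv : v ∈ Q '' D
    · obtain ⟨X, hX⟩ := hv
      exact ⟨X, fun _ => hX⟩
    · exact ⟨0, fun h => (hv h).elim⟩
  choose rep hrep using hrep
  obtain ⟨g₀, hg₀, hg₀Q⟩ := exists_interpolation (e := e) hh hm hr hQ.toFinset
    fun v => padTokens N (f (rep v))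
  -- The inequality is strict so that the `M` half-open cells also cover the endpoint `b`.
  obtain ⟨M, hM⟩ := exists_nat_gt (2 * b / s)
  rw [div_lt_iff₀ hs] at hM
  obtain ⟨ψ, hψ, hψb, hψQ⟩ := exists_quantizers (n := N) (d := d) (e := e) (h := h) hr (-b) hs M
  obtain ⟨B₁, hB₁⟩ := hD.exists_bound_of_continuousOn hf
  obtain ⟨B₂, hB₂⟩ := (isCompact_closedBall (0 : TokenSeq N d) b).exists_bound_of_continuousOn
    ((continuous_firstTokens hn').comp hg₀.2).continuousOn
  refine ⟨fun t => g₀ ∘ fun X i k => ψ t (X i k), fun X => f (rep (Q X)), B₁ + B₂,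
    fun t => comp_mem_continuousPrimeTransformers hg₀ (hψ t), fun t X hX => ?_, fun X hX => ?_,
    fun X hX => ?_⟩
  -- Even in the gaps the quantizer stays between `-b` and its input, so `g₀` is only evaluated on a
  -- fixed compact ball.
  · refine (dist_le_norm_add_norm _ _).trans (add_le_add (hB₁ X hX) (hB₂ _ ?_))
    rw [mem_closedBall_zero_iff]
    refine (pi_norm_le_iff_of_nonneg hb0).2 fun i => (pi_norm_le_iff_of_nonneg hb0).2 fun k => ?_
    obtain ⟨h1, h2⟩ := hψb t _ (hpad hX i k).1
    exact abs_le.2 ⟨h1, h2.trans (hpad hX i k).2⟩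
  · obtain ⟨h1, h2⟩ := hrep (Q X) (Set.mem_image_of_mem _ hX)
    exact hfs X hX _ h1 (dist_le_of_gridRound_padTokens_eq hn hs (fun i k => (hmem hX i k).1)
      (fun i k => (hmem h1 i k).1) h2.symm)
  · have hev : ∀ᶠ t in Filter.atTop, ∀ i k, ψ t (padTokens N X i k) = Q X i k :=
      Filter.eventually_all.2 fun i => Filter.eventually_all.2 fun k =>
        hψQ _ (hpad hX i k).1 (by linarith [(hpad hX i k).2])
    filter_upwards [hev] with t ht
    have : (fun i k => ψ t (padTokens N X i k)) = Q X := funext fun i => funext (ht i)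
    simp only [Function.comp_apply, this]
    rw [hg₀Q _ (hQ.mem_toFinset.2 (Set.mem_image_of_mem _ hX)), firstTokens_padTokens]

/-- The sum in `lpDist` is controlled by the distance. -/
theorem sum_enorm_rpow_le {n d : ℕ} {p : ℝ} (hp : 0 ≤ p) {X Y : TokenSeq n d} {B : ℝ}
    (h : dist X Y ≤ B) :
    ∑ i, ∑ k, ‖X i k - Y i k‖ₑ ^ p ≤ (n * d : ℕ) * ENNReal.ofReal B ^ p := by
  have hle (i k) : ‖X i k - Y i k‖ₑ ^ p ≤ ENNReal.ofReal B ^ p := by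
    refine ENNReal.rpow_le_rpow ?_ hp
    rw [← ofReal_norm, ← dist_eq_norm]
    exact ENNReal.ofReal_le_ofReal (((dist_le_pi_dist (X i) (Y i) k).trans
      (dist_le_pi_dist X Y i)).trans h)
  refine (Finset.sum_le_sum fun i _ => Finset.sum_le_sum fun k _ => hle i k).trans ?_
  simp [mul_assoc]

/-- Universal approximation in `L^p` by continuous prime transformers on padded sequences. -/
theorem exists_lpDist_le {n n' N d m : ℕ} (hn : n ≤ N) (hn' : n' ≤ N) (e : Score m) {h r : ℕ}
    (hh : 1 ≤ h) (hm : 1 ≤ m) (hr : 4 ≤ r) {D : Set (TokenSeq n d)} (hD : IsCompact D)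
    {f : TokenSeq n d → TokenSeq n' d} (hf : ContinuousOn f D) {p : ℝ} (hp : 1 ≤ p) {ε : ℝ}
    (hε : 0 < ε) :
    ∃ g ∈ continuousPrimeTransformers N d e h r,
      lpDist p D f (fun X => firstTokens hn' (g (padTokens N X))) ≤ ENNReal.ofReal ε := by
  have hp0 : 0 < p := zero_lt_one.trans_le hp
  have hvol : volume D ≠ ∞ := hD.measure_lt_top.ne
  set K : ℝ := (n' * d : ℕ) * (volume D).toReal with hK
  have hK0 : 0 ≤ K := by positivity
  -- The choice works because `K < K + 1 ≤ (K + 1) ^ p` for `p ≥ 1`.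
  have hδ : 0 < ε / (K + 1) := by positivity
  obtain ⟨g, S, B, hg, hB, hS, hlim⟩ := exists_eventually_eq_approx hn hn' e hh hm hr hD hf hδ
  let F (t : ℕ) (X : TokenSeq n d) : ℝ≥0∞ :=
    ∑ i, ∑ k, ‖f X i k - firstTokens hn' (g t (padTokens N X)) i k‖ₑ ^ p
  have hDm := hD.measurableSet
  have hfm := hf.aemeasurable (μ := volume) hDm
  have hFm (t : ℕ) : AEMeasurable (F t) (volume.restrict D) := by
    have hgm : Measurable fun X : TokenSeq n d => firstTokens hn' (g t (padTokens N X)) :=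
      ((continuous_firstTokens hn').comp ((hg t).2.comp (continuous_padTokens N))).measurable
    refine Finset.aemeasurable_fun_sum _ fun i _ => Finset.aemeasurable_fun_sum _ fun k _ => ?_
    refine (((aemeasurable_pi_iff.1 (aemeasurable_pi_iff.1 hfm i) k).sub
      ?_).enorm).pow_const p
    exact ((measurable_pi_apply k).comp ((measurable_pi_apply i).comp hgm)).aemeasurable
  -- The integrands are eventually equal to the limit at each point of `D`, and a constant dominates
  -- them on this set of finite measure.
  have hconv := tendsto_lintegral_of_dominated_convergence' (μ := volume.restrict D) (F := F)
    (f := fun X => ∑ i, ∑ k, ‖f X i k - S X i k‖ₑ ^ p)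
    (fun _ => (n' * d : ℕ) * ENNReal.ofReal B ^ p) hFm
    (fun t => (ae_restrict_iff' hDm).2 (.of_forall fun X hX =>
      sum_enorm_rpow_le hp0.le (hB t X hX)))
    (by
      rw [lintegral_const, Measure.restrict_apply_univ]
      exact ENNReal.mul_ne_top (ENNReal.mul_ne_top (ENNReal.natCast_ne_top _)
        (ENNReal.rpow_ne_top_of_nonneg hp0.le (by simp))) hvol)
    ((ae_restrict_iff' hDm).2 (.of_forall fun X hX =>
      tendsto_const_nhds.congr' ((hlim X hX).mono fun t ht => by simp only [F, ht])))
  have hlt : ∫⁻ X in D, ∑ i, ∑ k, ‖f X i k - S X i k‖ₑ ^ p < ENNReal.ofReal ε ^ p := by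
    calc ∫⁻ X in D, ∑ i, ∑ k, ‖f X i k - S X i k‖ₑ ^ p
        ≤ ∫⁻ _ in D, (n' * d : ℕ) * ENNReal.ofReal (ε / (K + 1)) ^ p :=
          setLIntegral_mono' hDm fun X hX => sum_enorm_rpow_le hp0.le (hS X hX)
      _ = ENNReal.ofReal (K * (ε / (K + 1)) ^ p) := by
          rw [lintegral_const, Measure.restrict_apply_univ, ENNReal.ofReal_rpow_of_pos hδ, hK,
            mul_right_comm, ENNReal.ofReal_mul (by positivity), ENNReal.ofReal_mul (by positivity),
            ENNReal.ofReal_toReal hvol, ENNReal.ofReal_natCast]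
      _ < ENNReal.ofReal ε ^ p := by
          rw [ENNReal.ofReal_rpow_of_pos hε, ENNReal.ofReal_lt_ofReal_iff (by positivity),
            Real.div_rpow hε.le (by positivity), mul_div_assoc', div_lt_iff₀ (by positivity),
            mul_comm K]
          have := Real.self_le_rpow_of_one_le (show 1 ≤ K + 1 by linarith) hp
          gcongr
          linarith
  obtain ⟨t, ht⟩ := (hconv.eventually_lt_const hlt).exists
  refine ⟨g t, hg t, ?_⟩
  calc lpDist p D f (fun X => firstTokens hn' (g t (padTokens N X)))
      ≤ (ENNReal.ofReal ε ^ p) ^ (1 / p) := ENNReal.rpow_le_rpow ht.le (by positivity)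
    _ = ENNReal.ofReal ε := by rw [one_div, ENNReal.rpow_rpow_inv hp0.ne']

theorem mem_withPositionalEncoding_self {n d : ℕ} {S : Set (TokenSeq n d → TokenSeq n d)}
    {g : TokenSeq n d → TokenSeq n d} (hg : g ∈ S) : g ∈ withPositionalEncoding S :=
  ⟨0, g, hg, by simp⟩

end PrimeAttention

theorem mainTheorem3 :
    -- all-ones primers turn prime attention into standard attention
    (∀ (n d m : ℕ) (e : PrimeAttention.Score m) (θ : PrimeAttention.HeadParams d m)
        (X : PrimeAttention.TokenSeq n d),
      PrimeAttention.primeAttention e θ (fun _ _ _ => 1) X =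
        PrimeAttention.standardAttention e θ X) ∧
    -- every function represented by standard attention is represented by prime attention
    (∀ (n d m : ℕ) (e : PrimeAttention.Score m),
      PrimeAttention.standardAttentionClass n d e ⊆ PrimeAttention.primeAttentionClass n d e ∧
      ∀ h r : ℕ,
        PrimeAttention.standardTransformers n d e h r ⊆
          PrimeAttention.primeTransformers n d e h r ∧
        PrimeAttention.withPositionalEncoding (PrimeAttention.standardTransformers n d e h r) ⊆
          PrimeAttention.withPositionalEncoding (PrimeAttention.primeTransformers n d e h r)) ∧
    -- universal approximation by prime-attention transformers
    (∀ (n d m : ℕ) (e : PrimeAttention.Score m) (h r : ℕ), 2 ≤ h → 1 ≤ m → 4 ≤ r →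
      ∀ (D : Set (PrimeAttention.TokenSeq n d)), IsCompact D →
      ∀ (f : PrimeAttention.TokenSeq n d → PrimeAttention.TokenSeq n d), ContinuousOn f D →
      ∀ (p : ℝ), 1 ≤ p → ∀ (ε : ℝ), 0 < ε →
      ∃ g ∈ PrimeAttention.withPositionalEncoding (PrimeAttention.primeTransformers n d e h r),
        PrimeAttention.lpDist p D f g ≤ ENNReal.ofReal ε) ∧
    -- the same for maps between sequences of different lengths, through padding and truncation
    (∀ (n n' N d m : ℕ) (_ : n ≤ N) (hn' : n' ≤ N) (e : PrimeAttention.Score m) (h r : ℕ),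
      2 ≤ h → 1 ≤ m → 4 ≤ r →
      ∀ (D : Set (PrimeAttention.TokenSeq n d)), IsCompact D →
      ∀ (f : PrimeAttention.TokenSeq n d → PrimeAttention.TokenSeq n' d), ContinuousOn f D →
      ∀ (p : ℝ), 1 ≤ p → ∀ (ε : ℝ), 0 < ε →
      ∃ g ∈ PrimeAttention.withPositionalEncoding (PrimeAttention.primeTransformers N d e h r),
        PrimeAttention.lpDist p D f
          (fun X => PrimeAttention.firstTokens hn' (g (PrimeAttention.padTokens N X))) ≤
            ENNReal.ofReal ε) := by
  refine ⟨fun n d m e θ X => by rw [PrimeAttention.primeAttention_one], fun n d m e => ⟨?_,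
    fun h r => ?_⟩, fun n d m e h r hh hm hr D hD f hf p hp ε hε => ?_,
    fun n n' N d m hn hn' e h r hh hm hr D hD f hf p hp ε hε => ?_⟩
  · rintro _ ⟨θ, rfl⟩
    exact ⟨θ, _, (PrimeAttention.primeAttention_one e θ).symm⟩
  · have := PrimeAttention.standardTransformers_subset_primeTransformers n d e h r
    exact ⟨this, PrimeAttention.withPositionalEncoding_mono this⟩
  · obtain ⟨g, hg, hgf⟩ := PrimeAttention.exists_lpDist_le le_rfl (le_refl n) e
      (one_le_two.trans hh) hm hr hD hf hp hε
    refine ⟨g, PrimeAttention.mem_withPositionalEncoding_self hg.1, ?_⟩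
    have hpad (X : PrimeAttention.TokenSeq n d) : PrimeAttention.padTokens n X = X :=
      PrimeAttention.firstTokens_padTokens le_rfl X
    have hfirst (X : PrimeAttention.TokenSeq n d) :
        PrimeAttention.firstTokens (le_refl n) X = X := rfl
    simpa only [hpad, hfirst] using hgf
  · obtain ⟨g, hg, hgf⟩ := PrimeAttention.exists_lpDist_le hn hn' e
      (one_le_two.trans hh) hm hr hD hf hp hε
    exact ⟨g, PrimeAttention.mem_withPositionalEncoding_self hg.1, hgf⟩
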